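/- Let $\mathcal S,\mathcal A,\Phi$ be metric spaces (e.g. subsets of Euclidean spaces; distances are written $\|x-y\|$), $\Xi$ a measurable space, $\gamma\in[0,1)$, and $T\ge 0$, $n\ge 1$, $m\ge 0$ integers. The training environment has a transition function $\mathcal T:\mathcal S\times\mathcal A\times\Xi\to\mathcal S$, an initialization function $\mathcal I:\Xi\to\mathcal S$ and a reward $r:\mathcal S\times\mathcal A\to\mathbb R$; the testing environment has $\mathcal T',\mathcal I',r'$ and a distractor $f:\mathcal S\to\mathcal S$ (all measurable). Let $\phi:\mathcal S\to\Phi$ be an encoder and $\pi(\cdot;\theta):\Phi\to\mathcal A$ policies with parameter $\theta\in\Theta\subseteq\mathbb R^m$, where $\|\theta\|\le K$ on $\Theta$, $K>0$. For noise $\xi=(\xi_0,\dots,\xi_T)\in\Xi^{T+1}$ let $\tau(\xi;\pi,\mathcal T,\mathcal I)=(s_0,\dots,s_T)$ be given by $s_0=\mathcal I(\xi_0)$, $s_{t+1}=\mathcal T(s_t,\pi(\phi(s_t);\theta),\xi_t)$. Along such a trajectory put $$J(\phi(\tau))=\sum_{t=0}^T\gamma^t r(s_t,\pi(\phi(s_t);\theta)),\qquad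 J'(\phi(f(\tau)))=\sum_{t=0}^T\gamma^t r'(s_t,\pi(\phi(f(s_t));\theta)).$$ Suppose that, for nonnegative Lipschitz constants and for all $s,s'\in\mathcal S$, $a,a'\in\mathcal A$, $\xi\in\Xi$, $x,x'\in\Phi$, $\theta,\theta'\in\Theta$, - $\|\mathcal T(s,a,\xi)-\mathcal T(s',a,\xi)\|\le L_{t_1}\|s-s'\|$ and $\|\mathcal T(s,a,\xi)-\mathcal T(s,a',\xi)\|\le L_{t_2}\|a-a'\|$; - $\|\pi(x;\theta)-\pi(x';\theta)\|\le L_{\pi_1}\|x-x'\|$ and $\|\pi(x;\theta)-\pi(x;\theta')\|\le L_{\pi_2}\|\theta-\theta'\|$; - $|r(s,a)|\le r_{\max}$ with $r_{\max}>0$, $|r(s,a)-r(s',a)|\le L_{r_1}\|s-s'\|$ and $|r(s,a)-r(s,a')|\le L_{r_2}\|a-a'\|$; - $\|\phi(s)-\phi(s')\|\le L_\phi\|s-s'\|$ and $\|\phi(f(s))-\phi(s)\|\le\varrho$; - $\|\mathcal T(s,a,\xi)-\mathcal T'(s,a,\xi)\|\le\zeta$, $\|\mathcal I(\xi)-\mathcal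 I'(\xi)\|\le\epsilon$ and $|r(s,a)-r'(s,a)|\le\epsilon_r$. Put $\nu=L_{t_1}+L_{t_2}L_{\pi_1}L_\phi$, $\lambda=L_{r_1}+L_{r_2}L_{\pi_1}L_\phi$ and $L_J=\sum_{t=0}^T\gamma^t\bigl(\lambda L_{t_2}L_{\pi_2}\frac{\nu^t-1}{\nu-1}+L_{r_2}L_{\pi_2}\bigr)$, where $\frac{\nu^t-1}{\nu-1}$ is read as $t$ if $\nu=1$. Let $q$ be a probability measure on $\Xi^{T+1}$ and let the noises $\xi_1,\dots,\xi_n$ of the $n$ training episodes be i.i.d. with law $q$. Then there are an absolute constant $C_1>0$ and, for every $\delta_0<1$, a constant $C_2>0$ depending only on $\gamma$ and $\delta_0$, such that for every $\delta\in(0,\delta_0]$, with probability at least $1-\delta$, simultaneously for all policies $\pi=\pi(\cdot;\theta)$, $\theta\in\Theta$, $$\Bigl|\mathbb E_{\xi\sim q}\bigl[J'(\phi(f(\tau(\xi;\pi,\mathcal T',\mathcal I'))))\bigr]-\frac1n\sum_{i=1}^nJ(\phi(\tau(\xi_i;\pi,\mathcal T,\mathcal I)))\Bigr|$$ $$\le\lambda\zeta\sum_{t=0}^T\gamma^t\frac{\nu^t-1}{\nu-1}+\lambda\epsilon\sum_{t=0}^T\gamma^t\nu^t+\frac{1-\gamma^{T+1}}{1-\gamma}\bigl(L_{r_2}L_{\pi_1}\varrho+\epsilon_r\bigr)+C_1L_JK\sqrt{\frac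 mn}+C_2\,r_{\max}\sqrt{\frac{\log(1/\delta)}n}.$$ -/

import Mathlib

open MeasureTheory ProbabilityTheory

namespace VisualRL

/-- The quotient `(ν ^ t - 1) / (ν - 1)`, with its continuous extension `t` at `ν = 1`. -/
noncomputable def geomQuot (ν : ℝ) (t : ℕ) : ℝ :=
  if ν = 1 then (t : ℝ) else (ν ^ t - 1) / (ν - 1)

section Dynamics

variable {S A Ξ : Type*} {T : ℕ}

/-- The trajectory `s₀, …, s_T` of the reparameterized system with transition function `trans`
and initialization function `init`, driven by the state feedback `g` (the action in state `s`
is `g s`) and the noise `ξ₀, …, ξ_T`: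
`s₀ = init ξ₀` and `s_{t+1} = trans s_t (g s_t) ξ_t`. -/
def trajectory (trans : S → A → Ξ → S) (init : Ξ → S) (g : S → A) (ξ : Fin (T + 1) → Ξ)
    (t : Fin (T + 1)) : S :=
  Fin.induction (motive := fun _ => S) (init (ξ 0)) (fun i s => trans s (g s) (ξ i.castSucc)) t

/-- The discounted return `∑_{t=0}^T γ^t r(s_t, h(s_t))` of a trajectory `s`, when the action
that is rewarded in state `s_t` is `h s_t`. -/
noncomputable def discountedReturn (γ : ℝ) (r : S → A → ℝ) (h : S → A)
    (s : Fin (T + 1) → S) : ℝ :=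
  ∑ t : Fin (T + 1), γ ^ (t : ℕ) * r (s t) (h (s t))

variable {Φ P : Type*}

/-- `J(φ(τ(ξ; π_θ, 𝒯, ℐ)))`: the return, without distractor, along the trajectory generated by
the policy `s ↦ π(φ(s); θ)`. -/
noncomputable def cleanReturn (γ : ℝ) (r : S → A → ℝ) (trans : S → A → Ξ → S) (init : Ξ → S)
    (φ : S → Φ) (π : Φ → P → A) (θ : P) (ξ : Fin (T + 1) → Ξ) : ℝ :=
  discountedReturn γ r (fun s => π (φ s) θ) (trajectory trans init (fun s => π (φ s) θ) ξ)

/-- `J(φ(f(τ(ξ; π_θ, 𝒯, ℐ)))) = ∑_t γ^t r(s_t, π(φ(f(s_t)); θ))`: the return with distractor `f`,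
where `s_0, …, s_T` is the trajectory `τ(ξ; π_θ, 𝒯, ℐ)` generated by `s ↦ π(φ(s); θ)`. -/
noncomputable def distractedReturn (γ : ℝ) (r : S → A → ℝ) (trans : S → A → Ξ → S)
    (init : Ξ → S) (φ : S → Φ) (f : S → S) (π : Φ → P → A) (θ : P)
    (ξ : Fin (T + 1) → Ξ) : ℝ :=
  discountedReturn γ r (fun s => π (φ (f s)) θ)
    (trajectory trans init (fun s => π (φ s) θ) ξ)

end Dynamics

section Assumptions

/- Throughout, `dist x y` is `‖x - y‖`; state, action and representation spaces are allowed to be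
arbitrary metric spaces, in particular arbitrary subsets of Euclidean spaces. -/

variable {S A Ξ Φ P : Type*} [MetricSpace S] [MetricSpace A] [MetricSpace Φ] [MetricSpace P]

/-- The transition function is `Lt1`-Lipschitz in the state and `Lt2`-Lipschitz in the action. -/
structure TransitionLipschitz (trans : S → A → Ξ → S) (Lt1 Lt2 : ℝ) : Prop where
  nonneg_state : 0 ≤ Lt1
  nonneg_action : 0 ≤ Lt2
  state : ∀ s s' a ξ, dist (trans s a ξ) (trans s' a ξ) ≤ Lt1 * dist s s'
  action : ∀ s a a' ξ, dist (trans s a ξ) (trans s a' ξ) ≤ Lt2 * dist a a'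

/-- On the parameter set `Θ`, the policy is `Lp1`-Lipschitz in the representation and
`Lp2`-Lipschitz in the parameter. -/
structure PolicyLipschitz (π : Φ → P → A) (Θ : Set P) (Lp1 Lp2 : ℝ) : Prop where
  nonneg_repr : 0 ≤ Lp1
  nonneg_param : 0 ≤ Lp2
  repr : ∀ x x', ∀ θ ∈ Θ, dist (π x θ) (π x' θ) ≤ Lp1 * dist x x'
  param : ∀ x, ∀ θ ∈ Θ, ∀ θ' ∈ Θ, dist (π x θ) (π x θ') ≤ Lp2 * dist θ θ'

/-- The reward is bounded by `rmax`, `Lr1`-Lipschitz in the state and `Lr2`-Lipschitz in the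
action. -/
structure RewardRegular (r : S → A → ℝ) (rmax Lr1 Lr2 : ℝ) : Prop where
  nonneg_state : 0 ≤ Lr1
  nonneg_action : 0 ≤ Lr2
  bounded : ∀ s a, |r s a| ≤ rmax
  state : ∀ s s' a, |r s a - r s' a| ≤ Lr1 * dist s s'
  action : ∀ s a a', |r s a - r s a'| ≤ Lr2 * dist a a'

/-- The encoder is `Lφ`-Lipschitz. -/
structure EncoderLipschitz (φ : S → Φ) (Lφ : ℝ) : Prop where
  nonneg : 0 ≤ Lφ
  lipschitz : ∀ s s', dist (φ s) (φ s') ≤ Lφ * dist s s'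

/-- The transition functions of the training and the testing environment differ by at most `ζ`
and the initialization functions by at most `ε`. -/
structure TrainTestClose (trans trans' : S → A → Ξ → S) (init init' : Ξ → S) (ζ ε : ℝ) :
    Prop where
  trans_close : ∀ s a ξ, dist (trans s a ξ) (trans' s a ξ) ≤ ζ
  init_close : ∀ ξ, dist (init ξ) (init' ξ) ≤ ε

end Assumptions

/-- The Lipschitz constant
`L_J = ∑_{t=0}^T γ^t (lam * L_{t2} L_{π2} (ν^t - 1)/(ν - 1) + L_{r2} L_{π2})`
of the return as a function of the policy parameter. -/
noncomputable def returnLipConst (γ : ℝ) (T : ℕ) (lam ν Lt2 Lp2 Lr2 : ℝ) : ℝ :=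
  ∑ t ∈ Finset.range (T + 1), γ ^ t * (lam * Lt2 * Lp2 * geomQuot ν t + Lr2 * Lp2)

end VisualRL

/-! Feed both environments the same noise. The error then splits into a deterministic bias, which
compares test and training returns for one noise sequence, and the deviation of the empirical mean
of the training return from its expectation, uniformly in `θ`.

Bias: the closed-loop step is `ν`-Lipschitz in the state, so the distance of the two trajectories
obeys `d (t+1) ≤ ν * d t + ζ` with `d 0 ≤ ε` (`dist_trajectory_le`), and the closed-loop reward is
`lam`-Lipschitz. The same recursion, with `Lt2 * Lp2 * dist θ θ'` in place of `ζ` and equal initial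
states, shows that the return is `LJ`-Lipschitz in `θ`.

Deviation: by Hoeffding, the centred empirical mean has sub-Gaussian tails of scale `R = rmax / ((1
- γ) √n)`, and its increments have scale `L * dist θ θ'` with `L = LJ / √n`. Chaining along dyadic
nets of the parameter set gives the dimension term without a logarithm of `n`. A chain started from
a single point would attach `√log (1/δ)` also to `L K`. It starts instead at the first level `k₀`
with `L K ≤ R 2^k₀`: there a union bound over at most `4^(m k₀)` points costs order `R √m k₀ ≤ L K
√m`, and in all later links the confidence term is multiplied by at most `R` times a summable factor
(`uniform_deviation_of_subgaussian_increments`). -/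

namespace VisualRL

/-! ### Nets in Euclidean balls and chaining -/

section Chaining

/-- Points of norm at most `ρ` and at mutual distance at least `2` number at most `(ρ + 1) ^ m`. -/
theorem card_le_of_norm_le_of_separated {m : ℕ} {ρ : ℝ} (hρ : 0 ≤ ρ)
    (s : Finset (EuclideanSpace ℝ (Fin m))) (hs : ∀ c ∈ s, ‖c‖ ≤ ρ)
    (h : ∀ c ∈ s, ∀ d ∈ s, c ≠ d → 2 ≤ dist c d) : (s.card : ℝ) ≤ (ρ + 1) ^ m := by
  let μ : Measure (EuclideanSpace ℝ (Fin m)) := volume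
  have hsub : (⋃ c ∈ s, Metric.ball c 1) ⊆ Metric.ball (0 : EuclideanSpace ℝ (Fin m)) (ρ + 1) := by
    refine Set.iUnion₂_subset fun c hc => Metric.ball_subset_ball' ?_
    rw [dist_zero_right]
    linarith [hs c hc]
  have hdisj : (s : Set (EuclideanSpace ℝ (Fin m))).PairwiseDisjoint
      fun c => Metric.ball c (1 : ℝ) := by
    intro c hc d hd hcd
    exact Metric.ball_disjoint_ball (by linarith [h c hc d hd hcd])
  have hρ1 : 0 < ρ + 1 := by linarith
  have key : (s.card : ENNReal) * μ (Metric.ball 0 1)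
      ≤ ENNReal.ofReal ((ρ + 1) ^ m) * μ (Metric.ball 0 1) := by
    calc (s.card : ENNReal) * μ (Metric.ball 0 1) = μ (⋃ c ∈ s, Metric.ball c 1) := by
          rw [measure_biUnion_finset hdisj fun c _ => measurableSet_ball]
          simp only [μ.addHaar_ball_center, Finset.sum_const, nsmul_eq_mul]
      _ ≤ μ (Metric.ball 0 (ρ + 1)) := measure_mono hsub
      _ = ENNReal.ofReal ((ρ + 1) ^ m) * μ (Metric.ball 0 1) := by
          rw [μ.addHaar_ball_of_pos _ hρ1, finrank_euclideanSpace_fin]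
  have key' : (s.card : ENNReal) ≤ ENNReal.ofReal ((ρ + 1) ^ m) :=
    (ENNReal.mul_le_mul_iff_left (Metric.measure_ball_pos _ _ zero_lt_one).ne'
      measure_ball_lt_top.ne).1 key
  simpa using ENNReal.toReal_le_of_le_ofReal (pow_nonneg hρ1.le _) key'

/-- A subset of the ball of radius `K` has a net of mesh `2 K / 2 ^ k` with at most `4 ^ (m k)`
points. -/
theorem exists_finset_net {m : ℕ} {Θ : Set (EuclideanSpace ℝ (Fin m))} (hne : Θ.Nonempty)
    {K : ℝ} (hK : 0 < K) (hΘ : ∀ θ ∈ Θ, ‖θ‖ ≤ K) (k : ℕ) :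
    ∃ N : Finset (EuclideanSpace ℝ (Fin m)), (∀ t ∈ N, t ∈ Θ) ∧
      (∀ θ ∈ Θ, ∃ t ∈ N, dist θ t ≤ 2 * K / 2 ^ k) ∧ (N.card : ℝ) ≤ 4 ^ (m * k) := by
  classical
  -- Level 0 must have exactly one point, whereas the volume bound would give `2 ^ m`. For `k ≥ 1`
  -- the estimate `2 ^ k + 1 ≤ 4 ^ k` holds.
  rcases Nat.eq_zero_or_pos k with rfl | hk
  · obtain ⟨θ₀, h₀⟩ := hne
    refine ⟨{θ₀}, by simpa using h₀, fun θ hθ => ⟨θ₀, by simp, ?_⟩, by simp⟩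
    have := dist_le_norm_add_norm θ θ₀
    have := hΘ θ hθ
    have := hΘ θ₀ h₀
    simp only [pow_zero, div_one]
    linarith
  have hcard : ∀ s : Finset (EuclideanSpace ℝ (Fin m)), (∀ t ∈ s, t ∈ Θ) →
      (∀ c ∈ s, ∀ d ∈ s, c ≠ d → 2 * K / 2 ^ k ≤ dist c d) → (s.card : ℝ) ≤ 4 ^ (m * k) := by
    intro s hs hsep
    -- Rescaling by `2 ^ k / K` turns the separation into 2 and the radius into `2 ^ k`.
    have ha : 0 < 2 ^ k / K := by positivity
    have hinj : Function.Injective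
        (fun t : EuclideanSpace ℝ (Fin m) => ((2 : ℝ) ^ k / K) • t) :=
      smul_right_injective _ ha.ne'
    rw [← Finset.card_image_of_injective s hinj]
    refine (card_le_of_norm_le_of_separated (ρ := 2 ^ k) (by positivity) _ ?_ ?_).trans ?_
    · intro c hc
      obtain ⟨t, ht, rfl⟩ := Finset.mem_image.1 hc
      rw [norm_smul, Real.norm_of_nonneg ha.le, div_mul_eq_mul_div, div_le_iff₀ hK]
      exact mul_le_mul_of_nonneg_left (hΘ t (hs t ht)) (by positivity)
    · intro c hc d hd hcd
      obtain ⟨t, ht, rfl⟩ := Finset.mem_image.1 hc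
      obtain ⟨t', ht', rfl⟩ := Finset.mem_image.1 hd
      have h1 := hsep t ht t' ht' fun h => hcd (by rw [h])
      rw [dist_smul₀, Real.norm_of_nonneg ha.le]
      calc (2 : ℝ) = 2 ^ k / K * (2 * K / 2 ^ k) := by field_simp
        _ ≤ _ := mul_le_mul_of_nonneg_left h1 ha.le
    · rw [mul_comm m k, pow_mul]
      refine pow_le_pow_left₀ (by positivity) ?_ m
      have h2 : (2 : ℝ) ≤ 2 ^ k := by
        simpa using pow_le_pow_right₀ (one_le_two (α := ℝ)) hk
      have h4 : (4 : ℝ) ^ k = 2 ^ k * 2 ^ k := by rw [← mul_pow]; norm_num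
      nlinarith
  -- A separated set that is not a net can be enlarged by a far point; without a net this never
  -- stops, against the cardinality bound.
  by_contra! hcon
  have grow : ∀ c : ℕ, ∃ s : Finset (EuclideanSpace ℝ (Fin m)), (∀ t ∈ s, t ∈ Θ) ∧
      (∀ c ∈ s, ∀ d ∈ s, c ≠ d → 2 * K / 2 ^ k ≤ dist c d) ∧ s.card = c := by
    intro c
    induction c with
    | zero => exact ⟨∅, by simp, by simp, by simp⟩
    | succ c ih =>
      obtain ⟨s, hs, hsep, hc⟩ := ih
      obtain ⟨θ, hθ, hfar⟩ : ∃ θ ∈ Θ, ∀ t ∈ s, 2 * K / 2 ^ k < dist θ t := by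
        by_contra! h
        exact (hcon s hs h).not_ge (hcard s hs hsep)
      have hnot : θ ∉ s := fun h => by
        have := hfar θ h
        rw [dist_self] at this
        exact this.not_ge (by positivity)
      refine ⟨insert θ s, ?_, ?_, by rw [Finset.card_insert_of_notMem hnot, hc]⟩
      · intro t ht
        rcases Finset.mem_insert.1 ht with rfl | ht
        exacts [hθ, hs t ht]
      · intro u hu v hv huv
        rcases Finset.mem_insert.1 hu with hu | hu <;> rcases Finset.mem_insert.1 hv with hv | hv
        · exact absurd (hu.trans hv.symm) huv
        · rw [hu]; exact (hfar v hv).le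
        · rw [hv, dist_comm]; exact (hfar u hu).le
        · exact hsep u hu v hv huv
  obtain ⟨s, hs, hsep, hc⟩ := grow (4 ^ (m * k) + 1)
  have := hcard s hs hsep
  rw [hc] at this
  push_cast at this
  linarith

/-- The union bound over a net of at most `4 ^ (m k)` points. -/
theorem card_mul_exp_le {m k j : ℕ} {c δ s x : ℝ} (hδ : 0 < δ) (hs : 0 ≤ s)
    (hsδ : s ^ 2 = Real.log (1 / δ)) (hc : c ≤ 4 ^ (m * k))
    (hx : x = 2 * (Real.sqrt m * k + (j + 2) + s)) :
    c * (2 * Real.exp (-x ^ 2 / 2)) ≤ δ / 2 ^ (j + 1) := by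
  have hk : (k : ℝ) ≤ (k : ℝ) ^ 2 := by exact_mod_cast Nat.le_self_pow two_ne_zero k
  have hm : 0 ≤ Real.sqrt m := Real.sqrt_nonneg _
  have hmm : Real.sqrt m ^ 2 = m := Real.sq_sqrt (Nat.cast_nonneg m)
  have hk0 : (0 : ℝ) ≤ k := Nat.cast_nonneg k
  have hj0 : (0 : ℝ) ≤ j := Nat.cast_nonneg j
  have hm0 : (0 : ℝ) ≤ m := Nat.cast_nonneg m
  -- Expand the square in `x ^ 2 / 2 = 2 * (√m k + (j + 2) + s) ^ 2`: the three summands pay for the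
  -- size of the net (via `k ≤ k ^ 2`), for summability over `j`, and for `δ = exp (-s ^ 2)`.
  have hexp : -x ^ 2 / 2 ≤ -(2 * (m * k : ℕ) + (j + 2 : ℕ) + s ^ 2 : ℝ) := by
    have h1 : (Real.sqrt m * k) ^ 2 = m * (k : ℝ) ^ 2 := by rw [mul_pow, hmm]
    have h2 : 0 ≤ Real.sqrt m * k := mul_nonneg hm hk0
    have h3 := mul_le_mul_of_nonneg_left hk hm0
    subst hx
    push_cast
    nlinarith [mul_nonneg h2 hs, mul_nonneg h2 hj0, mul_nonneg hj0 hs]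
  have he1 : (2 : ℝ) ≤ Real.exp 1 := by linarith [Real.exp_one_gt_d9]
  have h4 : (4 : ℝ) ^ (m * k) ≤ Real.exp (2 * (m * k : ℕ)) := by
    calc (4 : ℝ) ^ (m * k) = (2 ^ 2) ^ (m * k) := by norm_num
      _ ≤ (Real.exp 1 ^ 2) ^ (m * k) := by gcongr
      _ = _ := by rw [← pow_mul, ← Real.exp_nat_mul]; push_cast; ring_nf
  have h2 : (2 : ℝ) ^ (j + 2) ≤ Real.exp (j + 2 : ℕ) := by
    calc (2 : ℝ) ^ (j + 2) ≤ Real.exp 1 ^ (j + 2) := by gcongr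
      _ = _ := by rw [← Real.exp_nat_mul, mul_one]
  have hd : Real.exp (-s ^ 2) = δ := by
    rw [hsδ, Real.log_div one_ne_zero hδ.ne', Real.log_one, zero_sub, neg_neg, Real.exp_log hδ]
  calc c * (2 * Real.exp (-x ^ 2 / 2))
      ≤ Real.exp (2 * (m * k : ℕ)) *
          (2 * Real.exp (-(2 * (m * k : ℕ) + (j + 2 : ℕ) + s ^ 2 : ℝ))) := by
        gcongr
        exact hc.trans h4
    _ = 2 * δ / Real.exp (j + 2 : ℕ) := by
        rw [neg_add, neg_add, Real.exp_add, Real.exp_add, hd, Real.exp_neg, Real.exp_neg]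
        field_simp
    _ ≤ 2 * δ / 2 ^ (j + 2) := by gcongr
    _ = δ / 2 ^ (j + 1) := by field_simp; ring

variable {m : ℕ} {Ω : Type*} [MeasurableSpace Ω]

/-- Only subadditivity is used, so `G` need not be measurable; this matters because the good event
is an intersection over an uncountable `Θ`. -/
theorem one_sub_le_measureReal_of_compl_le {μ : Measure Ω} [IsProbabilityMeasure μ]
    {G B : Set Ω} {δ : ℝ} (hB : μ.real B ≤ δ) (h : ∀ ω, ω ∉ B → ω ∈ G) : 1 - δ ≤ μ.real G := by
  have hcov : (Set.univ : Set Ω) ⊆ G ∪ B := fun ω _ => by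
    by_cases hω : ω ∈ B
    exacts [Or.inr hω, Or.inl (h ω hω)]
  have h1 : μ.real Set.univ ≤ μ.real (G ∪ B) := measureReal_mono hcov
  have h2 := measureReal_union_le (μ := μ) G B
  rw [probReal_univ] at h1
  linarith

/-- Uniform deviation bound by chaining, for a process on a subset `Θ` of the ball of radius `K`
in `ℝᵐ` whose values have sub-Gaussian tails of scale `R` and whose increments have sub-Gaussian
tails of scale `L * dist θ θ'`. The chain starts at the first dyadic scale at which `L K ≤ R 2^k`,
so that `log (1 / δ)` enters with the factor `R` only. -/
theorem uniform_deviation_of_subgaussian_increments {μ : Measure Ω} [IsProbabilityMeasure μ]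
    {Θ : Set (EuclideanSpace ℝ (Fin m))} {K L R M δ : ℝ} (hK : 0 < K) (hΘ : ∀ θ ∈ Θ, ‖θ‖ ≤ K)
    (hL : 0 ≤ L) (hR : 0 < R) (hM : 0 ≤ M) (hδ : 0 < δ)
    (Y : EuclideanSpace ℝ (Fin m) → Ω → ℝ)
    (hpt : ∀ θ ∈ Θ, ∀ x, 0 ≤ x → μ.real {ω | R * x < |Y θ ω|} ≤ 2 * Real.exp (-x ^ 2 / 2))
    (hinc : ∀ θ ∈ Θ, ∀ θ' ∈ Θ, ∀ x, 0 ≤ x →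
      μ.real {ω | L * dist θ θ' * x < |Y θ ω - Y θ' ω|} ≤ 2 * Real.exp (-x ^ 2 / 2))
    (hlip : ∀ θ ∈ Θ, ∀ θ' ∈ Θ, ∀ ω, |Y θ ω - Y θ' ω| ≤ M * dist θ θ')
    {s : ℝ} (hs : 0 ≤ s) (hsδ : s ^ 2 = Real.log (1 / δ)) :
    1 - δ ≤ μ.real {ω | ∀ θ ∈ Θ,
      |Y θ ω| ≤ 18 * (L * K * Real.sqrt m) + R * (37 + 10 * s)} := by
  classical
  rcases Θ.eq_empty_or_nonempty with rfl | hne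
  · simpa using hδ.le
  choose N hNΘ hNcov hNcard using exists_finset_net hne hK hΘ
  -- Minimality of `k₀` gives the second bound: if `k₀ = k + 1`, then `R * (k + 1) ≤ R * 2 ^ k < L *
  -- K`.
  obtain ⟨k₀, hk₀, hRk⟩ : ∃ k₀ : ℕ, L * K ≤ R * 2 ^ k₀ ∧ R * k₀ ≤ L * K := by
    have hex : ∃ k : ℕ, L * K ≤ R * 2 ^ k := by
      obtain ⟨k, hk⟩ := pow_unbounded_of_one_lt (L * K / R) (one_lt_two (α := ℝ))
      exact ⟨k, by rw [div_lt_iff₀ hR] at hk; linarith⟩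
    refine ⟨Nat.find hex, Nat.find_spec hex, ?_⟩
    rcases h : Nat.find hex with _ | k
    · simpa using mul_nonneg hL hK.le
    · have h1 : ¬ L * K ≤ R * 2 ^ k := Nat.find_min hex (by omega)
      have h2 : ((k + 1 : ℕ) : ℝ) ≤ 2 ^ k := by exact_mod_cast Nat.lt_two_pow_self
      nlinarith
  have hsm : 0 ≤ Real.sqrt m := Real.sqrt_nonneg _
  have hLK : 0 ≤ L * K := mul_nonneg hL hK.le
  -- Closed form of the accumulated bound: the initial union bound plus two telescoped series, from
  -- `(a + 1) / 2^(a+1) = (a + 2) / 2^a - (a + 3) / 2^(a+1)` and its analogue for `(j + 3 + s) /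
  -- 2^(j+1)`.
  set B : ℕ → ℝ := fun j => 2 * R * (Real.sqrt m * k₀ + 2 + s)
    + 8 * (L * K * Real.sqrt m) * ((k₀ + 2) / 2 ^ k₀ - ((k₀ + j : ℕ) + 2) / 2 ^ (k₀ + j))
    + 8 * R * ((4 + s) - (j + 4 + s) / 2 ^ j) with hBdef
  have level : ∀ j : ℕ, ∃ E : Set Ω, μ.real E ≤ δ * (1 - 1 / 2 ^ (j + 1)) ∧
      ∀ ω, ω ∉ E → ∀ t ∈ N (k₀ + j), |Y t ω| ≤ B j := by
    intro j
    induction j with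
    | zero =>
      have hx0 : 0 ≤ 2 * (Real.sqrt m * k₀ + ((0 : ℕ) + 2) + s) := by positivity
      refine ⟨⋃ t ∈ N k₀, {ω | R * (2 * (Real.sqrt m * k₀ + ((0 : ℕ) + 2) + s)) < |Y t ω|},
        ?_, ?_⟩
      · calc _ ≤ ∑ t ∈ N k₀, _ := measureReal_biUnion_finset_le _ _
          _ ≤ ∑ t ∈ N k₀, _ := Finset.sum_le_sum fun t ht => hpt t (hNΘ _ t ht) _ hx0
          _ ≤ δ / 2 ^ (0 + 1) := by
            rw [Finset.sum_const, nsmul_eq_mul]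
            exact card_mul_exp_le hδ hs hsδ (hNcard k₀) rfl
          _ = _ := by ring
      · intro ω hω t ht
        simp only [Set.mem_iUnion, not_exists, Set.mem_ofPred_eq, not_lt] at hω
        refine (hω t ht).trans (le_of_eq ?_)
        simp only [hBdef, Nat.cast_zero, add_zero, zero_add, pow_zero, div_one, sub_self, mul_zero]
        ring
    | succ j ih =>
      obtain ⟨E, hE, hEB⟩ := ih
      have hpar : ∀ t : EuclideanSpace ℝ (Fin m), t ∈ N (k₀ + (j + 1)) →
          ∃ t' ∈ N (k₀ + j), dist t t' ≤ 2 * K / 2 ^ (k₀ + j) :=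
        fun t ht => hNcov (k₀ + j) t (hNΘ _ t ht)
      choose! p hpN hpd using hpar
      set x : ℝ := 2 * (Real.sqrt m * (k₀ + (j + 1) : ℕ) + ((j + 1 : ℕ) + 2) + s) with hx
      have hx0 : 0 ≤ x := by positivity
      refine ⟨E ∪ ⋃ t ∈ N (k₀ + (j + 1)), {ω | L * dist t (p t) * x < |Y t ω - Y (p t) ω|},
        ?_, ?_⟩
      · refine (measureReal_union_le _ _).trans ?_
        have h1 : μ.real (⋃ t ∈ N (k₀ + (j + 1)),
            {ω | L * dist t (p t) * x < |Y t ω - Y (p t) ω|}) ≤ δ / 2 ^ (j + 1 + 1) := by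
          calc _ ≤ ∑ t ∈ N (k₀ + (j + 1)), _ := measureReal_biUnion_finset_le _ _
            _ ≤ ∑ t ∈ N (k₀ + (j + 1)), _ := Finset.sum_le_sum fun t ht =>
                hinc t (hNΘ _ t ht) (p t) (hNΘ _ _ (hpN t ht)) _ hx0
            _ ≤ δ / 2 ^ (j + 1 + 1) := by
              rw [Finset.sum_const, nsmul_eq_mul]
              exact card_mul_exp_le hδ hs hsδ (hNcard _) hx
        have h2 : δ * (1 - 1 / 2 ^ (j + 1)) + δ / 2 ^ (j + 1 + 1)
            = δ * (1 - 1 / 2 ^ (j + 1 + 1)) := by field_simp; ring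
        linarith
      · intro ω hω t ht
        simp only [Set.mem_union, Set.mem_iUnion, not_or, not_exists, Set.mem_ofPred_eq,
          not_lt] at hω
        have h1 := hω.2 t ht
        have h2 := hEB ω hω.1 (p t) (hpN t ht)
        have h3 : |Y t ω| ≤ |Y t ω - Y (p t) ω| + |Y (p t) ω| := by
          simpa using abs_add_le (Y t ω - Y (p t) ω) (Y (p t) ω)
        have h4 : L * dist t (p t) * x ≤ L * (2 * K / 2 ^ (k₀ + j)) * x := by
          gcongr
          exact hpd t ht
        have h5 : L * (2 * K / 2 ^ (k₀ + j)) * x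
            ≤ 8 * (L * K * Real.sqrt m) * ((k₀ + j + 1) / 2 ^ (k₀ + j + 1))
              + 8 * R * ((j + 3 + s) / 2 ^ (j + 1)) := by
          have h6 : L * K / 2 ^ k₀ ≤ R := by rw [div_le_iff₀ (by positivity)]; exact hk₀
          have h7 : L * (2 * K / 2 ^ (k₀ + j)) * x
            = 8 * (L * K * Real.sqrt m) * ((k₀ + j + 1) / 2 ^ (k₀ + j + 1))
              + 8 * (L * K / 2 ^ k₀) * ((j + 3 + s) / 2 ^ (j + 1)) := by
            rw [hx]
            push_cast
            field_simp
            ring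
          rw [h7]
          gcongr
        have h8 : B (j + 1) = B j + (8 * (L * K * Real.sqrt m) * ((k₀ + j + 1) / 2 ^ (k₀ + j + 1))
              + 8 * R * ((j + 3 + s) / 2 ^ (j + 1))) := by
          simp only [hBdef]
          push_cast
          rw [← add_assoc k₀ j 1]
          field_simp
          ring
        linarith
  -- The pathwise Lipschitz bound ends the chain after finitely many links at the cost of one more
  -- `R`. `M` affects only the length of the chain, not the final bound.
  obtain ⟨j, hj⟩ : ∃ j : ℕ, M * (2 * K / 2 ^ (k₀ + j)) ≤ R := by
    obtain ⟨j, hj⟩ := pow_unbounded_of_one_lt (M * (2 * K) / R) (one_lt_two (α := ℝ))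
    refine ⟨j, ?_⟩
    rw [div_lt_iff₀ hR] at hj
    rw [← mul_div_assoc, div_le_iff₀ (by positivity)]
    have : (2 : ℝ) ^ j ≤ 2 ^ (k₀ + j) := pow_le_pow_right₀ one_le_two (by omega)
    nlinarith
  -- 18 = 2 + 16, from the initial level through `R * k₀ ≤ L * K` and from the links; 36 = 4 + 32
  -- and 10 = 2 + 8 arise likewise.
  have hB : B j ≤ 18 * (L * K * Real.sqrt m) + R * (36 + 10 * s) := by
    have h1 : ((k₀ : ℝ) + 2) / 2 ^ k₀ ≤ 2 := by
      rw [div_le_iff₀ (by positivity)]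
      have h : ((k₀ + 1 : ℕ) : ℝ) ≤ 2 ^ k₀ := by exact_mod_cast Nat.lt_two_pow_self
      push_cast at h
      linarith [one_le_pow₀ (one_le_two (α := ℝ)) (n := k₀)]
    have h2 : 0 ≤ (((k₀ + j : ℕ) : ℝ) + 2) / 2 ^ (k₀ + j) := by positivity
    have h3 : 0 ≤ ((j : ℝ) + 4 + s) / 2 ^ j := by positivity
    have h4 : (L * K * Real.sqrt m) *
        ((k₀ + 2) / 2 ^ k₀ - ((k₀ + j : ℕ) + 2) / 2 ^ (k₀ + j)) ≤ (L * K * Real.sqrt m) * 2 :=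
      mul_le_mul_of_nonneg_left (by linarith) (by positivity)
    have h5 : R * ((4 + s) - (j + 4 + s) / 2 ^ j) ≤ R * (4 + s) :=
      mul_le_mul_of_nonneg_left (by linarith) hR.le
    have h6 := mul_le_mul_of_nonneg_right hRk hsm
    simp only [hBdef]
    nlinarith
  obtain ⟨E, hE, hEB⟩ := level j
  refine one_sub_le_measureReal_of_compl_le (hE.trans ?_) (fun ω hω θ hθ => ?_)
  · have : 0 ≤ δ * (1 / 2 ^ (j + 1)) := by positivity
    linarith
  · obtain ⟨t, ht, htd⟩ := hNcov (k₀ + j) θ hθ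
    have h1 := hEB ω hω t ht
    have h2 := hlip θ hθ t (hNΘ _ t ht) ω
    have h3 := mul_le_mul_of_nonneg_left htd hM
    have h4 : |Y θ ω| ≤ |Y θ ω - Y t ω| + |Y t ω| := by
      simpa using abs_add_le (Y θ ω - Y t ω) (Y t ω)
    linarith

end Chaining

/-! ### Concentration of the empirical mean -/

section Hoeffding

/-- **Hoeffding's inequality**, two-sided, for the empirical mean of a bounded function of an
i.i.d. sample. -/
theorem measureReal_lt_abs_integral_sub_mean_le {Ω X : Type*} [MeasurableSpace Ω]
    [MeasurableSpace X] {μ : Measure Ω} [IsProbabilityMeasure μ] {q : Measure X} {n : ℕ}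
    (hn : 0 < n) {ξ : Fin n → Ω → X} (hξ : ∀ i, Measurable (ξ i)) (hind : iIndepFun ξ μ)
    (hlaw : ∀ i, μ.map (ξ i) = q) {h : X → ℝ} (hh : Measurable h) {b : ℝ}
    (hb : ∀ x, |h x| ≤ b) (hb0 : 0 ≤ b) {x : ℝ} (hx : 0 ≤ x) :
    μ.real {ω | b / Real.sqrt n * x < |(∫ y, h y ∂q) - (1 / (n : ℝ)) * ∑ i, h (ξ i ω)|}
      ≤ 2 * Real.exp (-x ^ 2 / 2) := by
  have hn' : (0 : ℝ) < n := by exact_mod_cast hn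
  have hsn : 0 < Real.sqrt n := Real.sqrt_pos.2 hn'
  -- For `b = 0` the exponent below would be `0 / 0 = 0`, which is useless; here the strict
  -- inequality makes the event empty. The case does occur, for increments between equal parameters.
  rcases hb0.eq_or_lt with rfl | hbpos
  · have hz : ∀ y, h y = 0 := fun y => abs_nonpos_iff.1 (hb y)
    simp only [hz, integral_zero, Finset.sum_const_zero, mul_zero, sub_zero, abs_zero, zero_div,
      zero_mul, lt_irrefl, Set.ofPred_false, measureReal_empty]
    positivity
  have hint : ∀ i, ∫ ω, h (ξ i ω) ∂μ = ∫ y, h y ∂q := fun i => by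
    rw [← hlaw i, integral_map (hξ i).aemeasurable hh.aestronglyMeasurable]
  have hsub : ∀ i, HasSubgaussianMGF (fun ω => h (ξ i ω) - ∫ y, h y ∂q)
      ((‖b - -b‖₊ / 2) ^ 2) μ := fun i => by
    rw [← hint i]
    exact hasSubgaussianMGF_of_mem_Icc (hh.comp (hξ i)).aemeasurable
      (Filter.Eventually.of_forall fun ω => abs_le.1 (hb _))
  have hsub' : ∀ i, HasSubgaussianMGF (fun ω => (∫ y, h y ∂q) - h (ξ i ω))
      ((‖b - -b‖₊ / 2) ^ 2) μ := fun i => by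
    refine (hsub i).neg.congr (Filter.Eventually.of_forall fun ω => ?_)
    simp
  have hind1 : iIndepFun (fun i ω => h (ξ i ω) - ∫ y, h y ∂q) μ :=
    hind.comp (fun _ y => h y - ∫ y, h y ∂q) fun _ => hh.sub_const _
  have hind2 : iIndepFun (fun i ω => (∫ y, h y ∂q) - h (ξ i ω)) μ :=
    hind.comp (fun _ y => (∫ y, h y ∂q) - h y) fun _ => hh.const_sub _
  have hε : 0 ≤ Real.sqrt n * b * x := by positivity
  have hc : ((‖b - -b‖₊ / 2 : NNReal) : ℝ) = b := by
    push_cast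
    rw [Real.norm_of_nonneg (by linarith)]
    ring
  have hval : -(Real.sqrt n * b * x) ^ 2 / (2 * ∑ _i : Fin n, (‖b - -b‖₊ / 2 : NNReal) ^ 2)
      = -x ^ 2 / 2 := by
    rw [NNReal.coe_sum]
    simp only [NNReal.coe_pow, hc]
    rw [Finset.sum_const, Finset.card_univ, Fintype.card_fin, nsmul_eq_mul, mul_pow, mul_pow,
      Real.sq_sqrt hn'.le]
    field_simp
  have t1 := HasSubgaussianMGF.measure_sum_ge_le_of_iIndepFun hind1 (s := Finset.univ)
    (fun i _ => hsub i) hε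
  have t2 := HasSubgaussianMGF.measure_sum_ge_le_of_iIndepFun hind2 (s := Finset.univ)
    (fun i _ => hsub' i) hε
  rw [hval] at t1 t2
  refine (measureReal_mono ?_).trans ((measureReal_union_le _ _).trans
    ((add_le_add t1 t2).trans_eq (two_mul _).symm))
  intro ω hω
  simp only [Set.mem_ofPred_eq] at hω
  have hfac : (n : ℝ) * (b / Real.sqrt n * x) = Real.sqrt n * b * x := by
    rw [← Real.sq_sqrt hn'.le, Real.sqrt_sq hsn.le]
    field_simp
  have hmul := mul_lt_mul_of_pos_left hω hn'
  rw [hfac] at hmul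
  have hdiff : (n : ℝ) * ((∫ y, h y ∂q) - (1 / (n : ℝ)) * ∑ i, h (ξ i ω))
      = ∑ i, ((∫ y, h y ∂q) - h (ξ i ω)) := by
    rw [Finset.sum_sub_distrib, Finset.sum_const, Finset.card_univ, Fintype.card_fin,
      nsmul_eq_mul]
    field_simp
  rw [← abs_of_pos hn', ← abs_mul, abs_of_pos hn', hdiff] at hmul
  rcases lt_abs.1 hmul with h1 | h1
  · exact Or.inr h1.le
  · refine Or.inl (h1.le.trans_eq ?_)
    rw [← Finset.sum_neg_distrib]
    exact Finset.sum_congr rfl fun i _ => by ring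

end Hoeffding

end VisualRL

/-! ### Trajectories: perturbation growth, measurability and bounded returns -/

namespace VisualRL

theorem geomQuot_zero (ν : ℝ) : geomQuot ν 0 = 0 := by
  unfold geomQuot
  split_ifs <;> simp

/-- This recursion, uniform in `ν` including `ν = 1`, is the only form in which the quotient enters
the induction along trajectories. -/
theorem geomQuot_succ (ν : ℝ) (t : ℕ) : geomQuot ν (t + 1) = ν * geomQuot ν t + 1 := by
  unfold geomQuot
  split_ifs with h
  · rw [h]; push_cast; ring
  · have : ν - 1 ≠ 0 := sub_ne_zero.2 h
    field_simp
    ring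

theorem geomQuot_nonneg {ν : ℝ} (hν : 0 ≤ ν) (t : ℕ) : 0 ≤ geomQuot ν t := by
  induction t with
  | zero => rw [geomQuot_zero]
  | succ t ih => rw [geomQuot_succ]; positivity

section Trajectories

variable {S A Ξ Φ : Type*} {T : ℕ}

theorem trajectory_zero (trans : S → A → Ξ → S) (init : Ξ → S) (g : S → A)
    (ξ : Fin (T + 1) → Ξ) : trajectory trans init g ξ 0 = init (ξ 0) := rfl

theorem trajectory_succ (trans : S → A → Ξ → S) (init : Ξ → S) (g : S → A)
    (ξ : Fin (T + 1) → Ξ) (t : Fin T) :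
    trajectory trans init g ξ t.succ =
      trans (trajectory trans init g ξ t.castSucc) (g (trajectory trans init g ξ t.castSucc))
        (ξ t.castSucc) := rfl

theorem measurable_trajectory [MeasurableSpace S] [MeasurableSpace A] [MeasurableSpace Ξ]
    {trans : S → A → Ξ → S} {init : Ξ → S} {g : S → A}
    (htrans : Measurable fun p : S × A × Ξ => trans p.1 p.2.1 p.2.2) (hinit : Measurable init)
    (hg : Measurable g) (t : Fin (T + 1)) :
    Measurable fun ξ : Fin (T + 1) → Ξ => trajectory trans init g ξ t := by
  induction t using Fin.induction with
  | zero => exact hinit.comp (measurable_pi_apply 0)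
  | succ t ih =>
    exact htrans.comp (ih.prodMk ((hg.comp ih).prodMk (measurable_pi_apply t.castSucc)))

theorem measurable_discountedReturn_trajectory [MeasurableSpace S] [MeasurableSpace A]
    [MeasurableSpace Ξ] {trans : S → A → Ξ → S} {init : Ξ → S} {g h : S → A} {γ : ℝ}
    {r : S → A → ℝ}
    (htrans : Measurable fun p : S × A × Ξ => trans p.1 p.2.1 p.2.2) (hinit : Measurable init)
    (hr : Measurable fun p : S × A => r p.1 p.2) (hg : Measurable g) (hh : Measurable h) :
    Measurable fun ξ : Fin (T + 1) → Ξ =>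
      discountedReturn γ r h (trajectory trans init g ξ) := by
  unfold discountedReturn
  refine Finset.measurable_sum _ fun t _ => Measurable.const_mul ?_ _
  have := measurable_trajectory htrans hinit hg t
  exact hr.comp (this.prodMk (hh.comp this))

/-- Growth of the distance of two trajectories whose one-step maps differ by at most `c`. -/
theorem dist_trajectory_le [MetricSpace S] {trans trans' : S → A → Ξ → S} {init init' : Ξ → S}
    {g g' : S → A} {ν c e : ℝ} (hν : 0 ≤ ν)
    (hstep : ∀ s s' ξ, dist (trans s (g s) ξ) (trans' s' (g' s') ξ) ≤ ν * dist s s' + c)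
    (hinit : ∀ ξ, dist (init ξ) (init' ξ) ≤ e) (ξ : Fin (T + 1) → Ξ) (t : Fin (T + 1)) :
    dist (trajectory trans init g ξ t) (trajectory trans' init' g' ξ t)
      ≤ c * geomQuot ν t + e * ν ^ (t : ℕ) := by
  induction t using Fin.induction with
  | zero =>
    rw [trajectory_zero, trajectory_zero, Fin.val_zero, geomQuot_zero]
    simpa using hinit (ξ 0)
  | succ t ih =>
    rw [trajectory_succ, trajectory_succ, Fin.val_succ, geomQuot_succ, pow_succ]
    refine (hstep _ _ _).trans ?_
    rw [Fin.val_castSucc] at ih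
    nlinarith [mul_le_mul_of_nonneg_left ih hν]

theorem abs_discountedReturn_sub_le {γ : ℝ} (hγ : 0 ≤ γ) {r r' : S → A → ℝ} {h h' : S → A}
    {s s' : Fin (T + 1) → S} {B : ℕ → ℝ}
    (hB : ∀ t, |r (s t) (h (s t)) - r' (s' t) (h' (s' t))| ≤ B t) :
    |discountedReturn γ r h s - discountedReturn γ r' h' s'|
      ≤ ∑ t ∈ Finset.range (T + 1), γ ^ t * B t := by
  rw [Finset.sum_range fun t => γ ^ t * B t]
  unfold discountedReturn
  rw [← Finset.sum_sub_distrib]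
  refine (Finset.abs_sum_le_sum_abs _ _).trans (Finset.sum_le_sum fun t _ => ?_)
  rw [← mul_sub, abs_mul, abs_of_nonneg (pow_nonneg hγ _)]
  exact mul_le_mul_of_nonneg_left (hB t) (pow_nonneg hγ _)

theorem abs_discountedReturn_le {γ : ℝ} (hγ : 0 ≤ γ) (hγ1 : γ < 1) {r : S → A → ℝ} {h : S → A}
    {b : ℝ} (hb0 : 0 ≤ b) (hb : ∀ s a, |r s a| ≤ b) (s : Fin (T + 1) → S) :
    |discountedReturn γ r h s| ≤ b / (1 - γ) := by
  have h1 := abs_discountedReturn_sub_le hγ (r := r) (r' := fun _ _ => 0) (h := h) (h' := h)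
    (s := s) (s' := s) (B := fun _ => b) fun t => by simpa using hb _ _
  have h2 : discountedReturn γ (fun (_ : S) (_ : A) => (0 : ℝ)) h s = 0 := by
    simp [discountedReturn]
  rw [h2, sub_zero, ← Finset.sum_mul, geom_sum_eq hγ1.ne, ← neg_div_neg_eq, neg_sub, neg_sub,
    div_mul_eq_mul_div] at h1
  have h3 : 0 < 1 - γ := by linarith
  refine h1.trans (div_le_div_of_nonneg_right ?_ h3.le)
  nlinarith [pow_nonneg hγ (T + 1)]

end Trajectories

/-! ### Sensitivity of the return to parameter, environment and distractor -/

section Returns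

variable {S A Ξ Φ P : Type*} [MetricSpace S] [MetricSpace A] [MetricSpace Φ] [MetricSpace P]
  {T : ℕ} {trans trans' : S → A → Ξ → S} {init init' : Ξ → S} {r r' : S → A → ℝ} {φ : S → Φ}
  {f : S → S} {π : Φ → P → A} {Θ : Set P}
  {Lt1 Lt2 Lp1 Lp2 Lr1 Lr2 Lφ rmax ζ ε ϱ εr lam ν γ : ℝ}

theorem dist_policy_encoder_le (hπ : PolicyLipschitz π Θ Lp1 Lp2) (hφ : EncoderLipschitz φ Lφ)
    {θ : P} (hθ : θ ∈ Θ) (s s' : S) :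
    dist (π (φ s) θ) (π (φ s') θ) ≤ Lp1 * Lφ * dist s s' := by
  refine (hπ.repr _ _ θ hθ).trans ?_
  rw [mul_assoc]
  exact mul_le_mul_of_nonneg_left (hφ.lipschitz s s') hπ.nonneg_repr

/-- Source of measurability of the feedback: `Φ` carries no σ-algebra, so the composite `S → A` is
treated directly. -/
theorem continuous_policy_encoder (hπ : PolicyLipschitz π Θ Lp1 Lp2)
    (hφ : EncoderLipschitz φ Lφ) {θ : P} (hθ : θ ∈ Θ) : Continuous fun s => π (φ s) θ :=
  (LipschitzWith.of_dist_le_mul (K := ⟨Lp1 * Lφ, mul_nonneg hπ.nonneg_repr hφ.nonneg⟩)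
    fun s s' => dist_policy_encoder_le hπ hφ hθ s s').continuous

/-- The state acts on the next state directly (`Lt1`) and through the feedback action (`Lt2 * Lp1 *
Lφ`); changing the state first with the action frozen separates the two effects. -/
theorem dist_step_le (htr : TransitionLipschitz trans Lt1 Lt2) (hπ : PolicyLipschitz π Θ Lp1 Lp2)
    (hφ : EncoderLipschitz φ Lφ) (hν : ν = Lt1 + Lt2 * Lp1 * Lφ) {θ : P} (hθ : θ ∈ Θ)
    (s s' : S) (ξ : Ξ) :
    dist (trans s (π (φ s) θ) ξ) (trans s' (π (φ s') θ) ξ) ≤ ν * dist s s' := by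
  have h1 := dist_triangle (trans s (π (φ s) θ) ξ) (trans s' (π (φ s) θ) ξ)
    (trans s' (π (φ s') θ) ξ)
  have h2 := htr.state s s' (π (φ s) θ) ξ
  have h3 := htr.action s' (π (φ s) θ) (π (φ s') θ) ξ
  have h4 := mul_le_mul_of_nonneg_left (dist_policy_encoder_le hπ hφ hθ s s') htr.nonneg_action
  rw [hν]
  linarith

theorem abs_reward_sub_le (hr : RewardRegular r rmax Lr1 Lr2) (hπ : PolicyLipschitz π Θ Lp1 Lp2)
    (hφ : EncoderLipschitz φ Lφ) (hlam : lam = Lr1 + Lr2 * Lp1 * Lφ) {θ : P} (hθ : θ ∈ Θ)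
    (s s' : S) : |r s (π (φ s) θ) - r s' (π (φ s') θ)| ≤ lam * dist s s' := by
  have h1 := abs_sub_le (r s (π (φ s) θ)) (r s' (π (φ s) θ)) (r s' (π (φ s') θ))
  have h2 := hr.state s s' (π (φ s) θ)
  have h3 := hr.action s' (π (φ s) θ) (π (φ s') θ)
  have h4 := mul_le_mul_of_nonneg_left (dist_policy_encoder_le hπ hφ hθ s s') hr.nonneg_action
  rw [hlam]
  linarith

/-- The return is Lipschitz in the policy parameter. -/
theorem abs_cleanReturn_sub_le (hγ : 0 ≤ γ) (htr : TransitionLipschitz trans Lt1 Lt2)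
    (hπ : PolicyLipschitz π Θ Lp1 Lp2) (hr : RewardRegular r rmax Lr1 Lr2)
    (hφ : EncoderLipschitz φ Lφ) (hν : ν = Lt1 + Lt2 * Lp1 * Lφ)
    (hlam : lam = Lr1 + Lr2 * Lp1 * Lφ) {θ θ' : P} (hθ : θ ∈ Θ) (hθ' : θ' ∈ Θ)
    (ξ : Fin (T + 1) → Ξ) :
    |cleanReturn γ r trans init φ π θ ξ - cleanReturn γ r trans init φ π θ' ξ|
      ≤ returnLipConst γ T lam ν Lt2 Lp2 Lr2 * dist θ θ' := by
  have hν0 : 0 ≤ ν := by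
    rw [hν]
    exact add_nonneg htr.nonneg_state
      (mul_nonneg (mul_nonneg htr.nonneg_action hπ.nonneg_repr) hφ.nonneg)
  have hlam0 : 0 ≤ lam := by
    rw [hlam]
    exact add_nonneg hr.nonneg_state
      (mul_nonneg (mul_nonneg hr.nonneg_action hπ.nonneg_repr) hφ.nonneg)
  -- At a common state the two actions are at most `Lp2 * dist θ θ'` apart, which gives the one-step
  -- defect `c`; the initial states coincide, hence `e = 0`.
  have hd := dist_trajectory_le (trans := trans) (trans' := trans) (init := init) (init' := init)
    (g := fun s => π (φ s) θ) (g' := fun s => π (φ s) θ') (c := Lt2 * (Lp2 * dist θ θ')) (e := 0)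
    hν0 (fun s s' ξ => by
      have h1 := dist_triangle (trans s (π (φ s) θ) ξ) (trans s' (π (φ s') θ) ξ)
        (trans s' (π (φ s') θ') ξ)
      have h2 := dist_step_le htr hπ hφ hν hθ s s' ξ
      have h3 := htr.action s' (π (φ s') θ) (π (φ s') θ') ξ
      have h4 := mul_le_mul_of_nonneg_left (hπ.param (φ s') θ hθ θ' hθ') htr.nonneg_action
      linarith) (fun _ => (dist_self _).le) ξ
  refine (abs_discountedReturn_sub_le hγ (B := fun t =>
    (lam * Lt2 * Lp2 * geomQuot ν t + Lr2 * Lp2) * dist θ θ') fun t => ?_).trans_eq ?_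
  · set s := trajectory trans init (fun s => π (φ s) θ) ξ t
    set s' := trajectory trans init (fun s => π (φ s) θ') ξ t
    have h1 := abs_sub_le (r s (π (φ s) θ)) (r s' (π (φ s') θ)) (r s' (π (φ s') θ'))
    have h2 := abs_reward_sub_le hr hπ hφ hlam hθ s s'
    have h3 := hr.action s' (π (φ s') θ) (π (φ s') θ')
    have h4 := mul_le_mul_of_nonneg_left (hπ.param (φ s') θ hθ θ' hθ') hr.nonneg_action
    have h5 := mul_le_mul_of_nonneg_left (hd t) hlam0
    nlinarith
  · unfold returnLipConst
    rw [Finset.sum_mul]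
    exact Finset.sum_congr rfl fun t _ => by ring

/-- The bias between testing with distractor and training without it, for the same noise. -/
theorem abs_distractedReturn_sub_cleanReturn_le (hγ : 0 ≤ γ) (hγ1 : γ < 1)
    (htr : TransitionLipschitz trans Lt1 Lt2)
    (hπ : PolicyLipschitz π Θ Lp1 Lp2) (hr : RewardRegular r rmax Lr1 Lr2)
    (hclose : TrainTestClose trans trans' init init' ζ ε) (hφ : EncoderLipschitz φ Lφ)
    (hf : ∀ s, dist (φ (f s)) (φ s) ≤ ϱ) (hrr : ∀ s a, |r s a - r' s a| ≤ εr)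
    (hν : ν = Lt1 + Lt2 * Lp1 * Lφ)
    (hlam : lam = Lr1 + Lr2 * Lp1 * Lφ) {θ : P} (hθ : θ ∈ Θ) (ξ : Fin (T + 1) → Ξ) :
    |distractedReturn γ r' trans' init' φ f π θ ξ - cleanReturn γ r trans init φ π θ ξ|
      ≤ lam * ζ * ∑ t ∈ Finset.range (T + 1), γ ^ t * geomQuot ν t
          + lam * ε * ∑ t ∈ Finset.range (T + 1), γ ^ t * ν ^ t
          + (1 - γ ^ (T + 1)) / (1 - γ) * (Lr2 * Lp1 * ϱ + εr) := by
  have hν0 : 0 ≤ ν := by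
    rw [hν]
    exact add_nonneg htr.nonneg_state
      (mul_nonneg (mul_nonneg htr.nonneg_action hπ.nonneg_repr) hφ.nonneg)
  have hlam0 : 0 ≤ lam := by
    rw [hlam]
    exact add_nonneg hr.nonneg_state
      (mul_nonneg (mul_nonneg hr.nonneg_action hπ.nonneg_repr) hφ.nonneg)
  have hd := dist_trajectory_le (trans := trans) (trans' := trans') (init := init)
    (init' := init') (g := fun s => π (φ s) θ) (g' := fun s => π (φ s) θ) (c := ζ) (e := ε)
    hν0 (fun s s' ξ => by
      have h1 := dist_triangle (trans s (π (φ s) θ) ξ) (trans s' (π (φ s') θ) ξ)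
        (trans' s' (π (φ s') θ) ξ)
      have h2 := dist_step_le htr hπ hφ hν hθ s s' ξ
      have h3 := hclose.trans_close s' (π (φ s') θ) ξ
      linarith) hclose.init_close ξ
  rw [abs_sub_comm]
  refine (abs_discountedReturn_sub_le hγ (B := fun t =>
    lam * ζ * geomQuot ν t + lam * ε * ν ^ t + (Lr2 * Lp1 * ϱ + εr)) fun t => ?_).trans_eq ?_
  · set s := trajectory trans init (fun s => π (φ s) θ) ξ t
    set s' := trajectory trans' init' (fun s => π (φ s) θ) ξ t
    -- Change the state first, then the observed action through `f`, and the reward last: regularity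
    -- is then needed for `r` only, not for `r'`. The distractor affects the rewarded action but not
    -- the trajectory.
    have h1 := abs_sub_le (r s (π (φ s) θ)) (r s' (π (φ s') θ)) (r' s' (π (φ (f s')) θ))
    have h2 := abs_sub_le (r s' (π (φ s') θ)) (r s' (π (φ (f s')) θ)) (r' s' (π (φ (f s')) θ))
    have h3 := abs_reward_sub_le hr hπ hφ hlam hθ s s'
    have h4 := hr.action s' (π (φ s') θ) (π (φ (f s')) θ)
    have h5 : dist (π (φ s') θ) (π (φ (f s')) θ) ≤ Lp1 * ϱ := by
      rw [dist_comm]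
      exact (hπ.repr _ _ θ hθ).trans (mul_le_mul_of_nonneg_left (hf s') hπ.nonneg_repr)
    have h6 := mul_le_mul_of_nonneg_left h5 hr.nonneg_action
    have h7 := hrr s' (π (φ (f s')) θ)
    have h8 := mul_le_mul_of_nonneg_left (hd t) hlam0
    nlinarith
  · have hgeom : (1 - γ ^ (T + 1)) / (1 - γ) = ∑ t ∈ Finset.range (T + 1), γ ^ t := by
      rw [geom_sum_eq hγ1.ne, ← neg_div_neg_eq, neg_sub, neg_sub]
    rw [hgeom, Finset.mul_sum, Finset.mul_sum, Finset.sum_mul, ← Finset.sum_add_distrib,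
      ← Finset.sum_add_distrib]
    exact Finset.sum_congr rfl fun t _ => by ring

end Returns

theorem returnLipConst_nonneg {γ lam ν Lt2 Lp2 Lr2 : ℝ} {T : ℕ} (hγ : 0 ≤ γ) (hlam : 0 ≤ lam)
    (hν : 0 ≤ ν) (ht : 0 ≤ Lt2) (hp : 0 ≤ Lp2) (hr : 0 ≤ Lr2) :
    0 ≤ returnLipConst γ T lam ν Lt2 Lp2 Lr2 :=
  Finset.sum_nonneg fun t _ => by
    have := geomQuot_nonneg hν t
    positivity

end VisualRL

/-! ### Assembly of bias and deviation -/

theorem mainTheorem7 :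
    -- the constant of the first `O` is absolute
    ∃ C₁ : ℝ, 0 < C₁ ∧
    ∀ γ : ℝ, 0 ≤ γ → γ < 1 → ∀ δ₀ : ℝ, δ₀ < 1 →
    -- the constant of the second `O` depends only on the discount factor and on `δ₀`
    ∃ C₂ : ℝ, 0 < C₂ ∧
    ∀ (T n m : ℕ), 0 < n →
    ∀ (S A Φ Ξ Ω : Type*)
      [MetricSpace S] [MeasurableSpace S] [BorelSpace S]
      [MetricSpace A] [MeasurableSpace A] [BorelSpace A]
      [MetricSpace Φ] [MeasurableSpace Ξ] [MeasurableSpace Ω]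
      -- transition, initialization and reward functions, in training and in testing
      (trans trans' : S → A → Ξ → S) (init init' : Ξ → S) (r r' : S → A → ℝ)
      -- encoder, distractor, parameterized policy and its parameter set
      (φ : S → Φ) (f : S → S) (π : Φ → EuclideanSpace ℝ (Fin m) → A)
      (Θ : Set (EuclideanSpace ℝ (Fin m)))
      (Lt1 Lt2 Lp1 Lp2 Lr1 Lr2 Lφ rmax ζ ε ϱ εr K lam ν LJ δ : ℝ)
      -- law of the noise of one episode, and the noises of the `n` training episodes
      (q : Measure (Fin (T + 1) → Ξ)) [IsProbabilityMeasure q]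
      (μ : Measure Ω) [IsProbabilityMeasure μ]
      (ξ : Fin n → Ω → (Fin (T + 1) → Ξ)),
    Measurable (fun p : S × A × Ξ => trans p.1 p.2.1 p.2.2) →
    Measurable (fun p : S × A × Ξ => trans' p.1 p.2.1 p.2.2) →
    Measurable init → Measurable init' →
    Measurable (fun p : S × A => r p.1 p.2) →
    Measurable (fun p : S × A => r' p.1 p.2) →
    Measurable f →
    VisualRL.TransitionLipschitz trans Lt1 Lt2 →
    VisualRL.PolicyLipschitz π Θ Lp1 Lp2 →
    0 < rmax →
    VisualRL.RewardRegular r rmax Lr1 Lr2 →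
    VisualRL.TrainTestClose trans trans' init init' ζ ε →
    VisualRL.EncoderLipschitz φ Lφ →
    (∀ s, dist (φ (f s)) (φ s) ≤ ϱ) →
    (∀ s a, |r s a - r' s a| ≤ εr) →
    0 < K → (∀ θ ∈ Θ, ‖θ‖ ≤ K) →
    ν = Lt1 + Lt2 * Lp1 * Lφ →
    lam = Lr1 + Lr2 * Lp1 * Lφ →
    LJ = VisualRL.returnLipConst γ T lam ν Lt2 Lp2 Lr2 →
    -- the episodes are i.i.d. with law `q`
    (∀ i, Measurable (ξ i)) → iIndepFun ξ μ → (∀ i, μ.map (ξ i) = q) →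
    0 < δ → δ ≤ δ₀ →
    -- with probability at least `1 - δ`, the bound holds for all policies of the class
    1 - δ ≤ μ.real {ω | ∀ θ ∈ Θ,
      |(∫ x, VisualRL.distractedReturn γ r' trans' init' φ f π θ x ∂q)
          - (1 / (n : ℝ)) * ∑ i : Fin n, VisualRL.cleanReturn γ r trans init φ π θ (ξ i ω)|
        ≤ lam * ζ * ∑ t ∈ Finset.range (T + 1), γ ^ t * VisualRL.geomQuot ν t
          + lam * ε * ∑ t ∈ Finset.range (T + 1), γ ^ t * ν ^ t
          + (1 - γ ^ (T + 1)) / (1 - γ) * (Lr2 * Lp1 * ϱ + εr)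
          + C₁ * (LJ * K * Real.sqrt ((m : ℝ) / (n : ℝ)))
          + C₂ * (rmax * Real.sqrt (Real.log (1 / δ) / (n : ℝ)))} := by
  -- The summand `37 / √log (1/δ₀)` absorbs the deviation term free of `δ`, since `log (1/δ) ≥ log
  -- (1/δ₀)`. The constant is positive even for `δ₀ ≤ 0`, where no `δ` is admissible.
  refine ⟨18, by norm_num, fun γ hγ hγ1 δ₀ hδ₀ =>
    ⟨(37 / Real.sqrt (Real.log (1 / δ₀)) + 10) / (1 - γ), by
      have : 0 < 1 - γ := by linarith
      positivity, ?_⟩⟩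
  intro T n m hn S A Φ Ξ Ω _ _ _ _ _ _ _ _ _ trans trans' init init' r r' φ f π Θ
    Lt1 Lt2 Lp1 Lp2 Lr1 Lr2 Lφ rmax ζ ε ϱ εr K lam ν LJ δ q _ μ _ ξ htrans htrans' hinit hinit'
    hr hr' hf htr hπ hrmax hrew hclose hφ hdis hrr hK hΘ hν hlam hLJ hξ hind hlaw hδ hδδ₀
  have hγ' : 0 < 1 - γ := by linarith
  have hn' : (0 : ℝ) < n := by exact_mod_cast hn
  have hsn : 0 < Real.sqrt n := Real.sqrt_pos.2 hn'
  have hLJ0 : 0 ≤ LJ := by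
    have h1 := mul_nonneg hπ.nonneg_repr hφ.nonneg
    have h2 := mul_nonneg htr.nonneg_action h1
    have h3 := mul_nonneg hrew.nonneg_action h1
    rw [hLJ]
    exact VisualRL.returnLipConst_nonneg hγ (by linarith [hrew.nonneg_state])
      (by linarith [htr.nonneg_state]) htr.nonneg_action hπ.nonneg_param hrew.nonneg_action
  set R : ℝ := rmax / (1 - γ) with hR
  have hR0 : 0 < R := by positivity
  set J : EuclideanSpace ℝ (Fin m) → (Fin (T + 1) → Ξ) → ℝ :=
    fun θ => VisualRL.cleanReturn γ r trans init φ π θ with hJ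
  have hJmeas : ∀ θ ∈ Θ, Measurable (J θ) := fun θ hθ =>
    have hg := (VisualRL.continuous_policy_encoder hπ hφ hθ).measurable
    VisualRL.measurable_discountedReturn_trajectory htrans hinit hr hg hg
  have hJbdd : ∀ θ x, |J θ x| ≤ R := fun θ x =>
    VisualRL.abs_discountedReturn_le hγ hγ1 hrmax.le hrew.bounded _
  have hJlip : ∀ θ ∈ Θ, ∀ θ' ∈ Θ, ∀ x, |J θ x - J θ' x| ≤ LJ * dist θ θ' :=
    fun θ hθ θ' hθ' x => by
      rw [hLJ]
      exact VisualRL.abs_cleanReturn_sub_le hγ htr hπ hrew hφ hν hlam hθ hθ' x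
  have hJint : ∀ θ ∈ Θ, Integrable (J θ) q := fun θ hθ =>
    Integrable.of_bound (hJmeas θ hθ).aestronglyMeasurable R
      (Filter.Eventually.of_forall fun x => hJbdd θ x)
  set Y : EuclideanSpace ℝ (Fin m) → Ω → ℝ :=
    fun θ ω => (∫ x, J θ x ∂q) - (1 / (n : ℝ)) * ∑ i, J θ (ξ i ω) with hY
  have hYsub : ∀ θ ∈ Θ, ∀ θ' ∈ Θ, ∀ ω, Y θ ω - Y θ' ω =
      (∫ x, (J θ x - J θ' x) ∂q) - (1 / (n : ℝ)) * ∑ i, (J θ (ξ i ω) - J θ' (ξ i ω)) :=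
    fun θ hθ θ' hθ' ω => by
      rw [integral_sub (hJint θ hθ) (hJint θ' hθ'), Finset.sum_sub_distrib]
      simp only [hY]
      ring
  have hYlip : ∀ θ ∈ Θ, ∀ θ' ∈ Θ, ∀ ω, |Y θ ω - Y θ' ω| ≤ 2 * LJ * dist θ θ' := by
    intro θ hθ θ' hθ' ω
    rw [hYsub θ hθ θ' hθ' ω]
    have h1 : |∫ x, (J θ x - J θ' x) ∂q| ≤ LJ * dist θ θ' := by
      simpa using norm_integral_le_of_norm_le_const (μ := q) (f := fun x => J θ x - J θ' x)
        (C := LJ * dist θ θ') (Filter.Eventually.of_forall fun x => hJlip θ hθ θ' hθ' x)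
    have h2 : |(1 / (n : ℝ)) * ∑ i, (J θ (ξ i ω) - J θ' (ξ i ω))| ≤ LJ * dist θ θ' := by
      rw [abs_mul, abs_of_pos (by positivity), one_div, inv_mul_le_iff₀ hn']
      refine (Finset.abs_sum_le_sum_abs _ _).trans
        ((Finset.sum_le_sum fun i _ => hJlip θ hθ θ' hθ' (ξ i ω)).trans_eq ?_)
      simp
    linarith [abs_sub (∫ x, (J θ x - J θ' x) ∂q)
      ((1 / (n : ℝ)) * ∑ i, (J θ (ξ i ω) - J θ' (ξ i ω)))]
  have hlog₀ : 0 < Real.log (1 / δ₀) :=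
    Real.log_pos (by rw [lt_div_iff₀ (hδ.trans_le hδδ₀)]; linarith)
  have hlog : Real.log (1 / δ₀) ≤ Real.log (1 / δ) :=
    Real.log_le_log (one_div_pos.2 (hδ.trans_le hδδ₀)) (one_div_le_one_div_of_le hδ hδδ₀)
  have main := VisualRL.uniform_deviation_of_subgaussian_increments (μ := μ) (Θ := Θ) (K := K)
    (L := LJ / Real.sqrt n) (R := R / Real.sqrt n) (M := 2 * LJ) (δ := δ) hK hΘ
    (by positivity) (by positivity) (by positivity) hδ Y
    (fun θ hθ x hx => VisualRL.measureReal_lt_abs_integral_sub_mean_le hn hξ hind hlaw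
      (hJmeas θ hθ) (hJbdd θ) hR0.le hx)
    (fun θ hθ θ' hθ' x hx => by
      simp only [hYsub θ hθ θ' hθ']
      rw [div_mul_eq_mul_div]
      exact VisualRL.measureReal_lt_abs_integral_sub_mean_le hn hξ hind hlaw
        ((hJmeas θ hθ).sub (hJmeas θ' hθ')) (hJlip θ hθ θ' hθ')
        (mul_nonneg hLJ0 dist_nonneg) hx)
    hYlip (s := Real.sqrt (Real.log (1 / δ))) (Real.sqrt_nonneg _)
    (Real.sq_sqrt (hlog₀.le.trans hlog))
  refine main.trans (measureReal_mono fun ω hω θ hθ => ?_)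
  have hdev := hω θ hθ
  have hbias : |(∫ x, VisualRL.distractedReturn γ r' trans' init' φ f π θ x ∂q) - ∫ x, J θ x ∂q|
      ≤ lam * ζ * ∑ t ∈ Finset.range (T + 1), γ ^ t * VisualRL.geomQuot ν t
          + lam * ε * ∑ t ∈ Finset.range (T + 1), γ ^ t * ν ^ t
          + (1 - γ ^ (T + 1)) / (1 - γ) * (Lr2 * Lp1 * ϱ + εr) := by
    have hg := (VisualRL.continuous_policy_encoder hπ hφ hθ).measurable
    have hint' : Integrable (VisualRL.distractedReturn γ r' trans' init' φ f π θ) q := by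
      -- Boundedness of `r'` comes from that of `r` and their closeness; the absolute value of `εr`
      -- makes the bound nonnegative without knowing its sign.
      refine Integrable.of_bound (C := (rmax + |εr|) / (1 - γ))
        (VisualRL.measurable_discountedReturn_trajectory htrans' hinit' hr' hg
          (hg.comp hf)).aestronglyMeasurable
        (Filter.Eventually.of_forall fun x =>
          VisualRL.abs_discountedReturn_le hγ hγ1 (by positivity) (fun s a => ?_) _)
      have h1 := abs_sub_abs_le_abs_sub (r' s a) (r s a)
      rw [abs_sub_comm] at h1
      linarith [hrr s a, hrew.bounded s a, le_abs_self εr]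
    rw [← integral_sub hint' (hJint θ hθ)]
    have hle := norm_integral_le_of_norm_le_const (μ := q)
      (f := fun x => VisualRL.distractedReturn γ r' trans' init' φ f π θ x - J θ x)
      (Filter.Eventually.of_forall fun x =>
        (Real.norm_eq_abs _).trans_le <| VisualRL.abs_distractedReturn_sub_cleanReturn_le hγ hγ1 htr hπ hrew hclose hφ hdis hrr
          hν hlam hθ x)
    rwa [Real.norm_eq_abs, probReal_univ, mul_one] at hle
  have hC₁ : LJ / Real.sqrt n * K * Real.sqrt m = LJ * K * Real.sqrt ((m : ℝ) / (n : ℝ)) := by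
    rw [Real.sqrt_div (Nat.cast_nonneg m)]
    ring
  have hC₂ : R / Real.sqrt n * (37 + 10 * Real.sqrt (Real.log (1 / δ)))
      ≤ (37 / Real.sqrt (Real.log (1 / δ₀)) + 10) / (1 - γ)
        * (rmax * Real.sqrt (Real.log (1 / δ) / (n : ℝ))) := by
    have h1 : 37 ≤ 37 / Real.sqrt (Real.log (1 / δ₀)) * Real.sqrt (Real.log (1 / δ)) := by
      have h0 := Real.sqrt_pos.2 hlog₀
      rw [div_mul_eq_mul_div, le_div_iff₀ h0]
      exact mul_le_mul_of_nonneg_left (Real.sqrt_le_sqrt hlog) (by norm_num)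
    rw [Real.sqrt_div (hlog₀.le.trans hlog)]
    calc _ ≤ R / Real.sqrt n * (37 / Real.sqrt (Real.log (1 / δ₀)) * Real.sqrt (Real.log (1 / δ))
            + 10 * Real.sqrt (Real.log (1 / δ))) := by gcongr
      _ = _ := by rw [hR]; ring
  have htri := abs_sub_le (∫ x, VisualRL.distractedReturn γ r' trans' init' φ f π θ x ∂q)
    (∫ x, J θ x ∂q) ((1 / (n : ℝ)) * ∑ i, J θ (ξ i ω))
  rw [hC₁] at hdev
  simp only [hY] at hdev
  linarith
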